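/- **Theorem 1.** *Setting.* Alice sends a message $W\in\mathbb F_q^{b\times n}$ to Bob; put $X_0=(W\ \ I_b)$. The network is used in stages $j=1,2,\dots$. At stage $j$ it is a finite directed hypergraph whose hyperedges are ordered in time; each hyperedge carries one packet in $\mathbb F_q^{n+b}$ from its transmitting node to all of its receiving nodes. A path is a sequence of successive hyperedges, in increasing time order, each one transmitted by a node other than Alice that receives the previous one. Let $c_j$ be the number of hyperedges leaving Alice and $M_j$ the min cut from Alice to Bob (the least number of hyperedges meeting all paths that start with a hyperedge leaving Alice and end at Bob). *Encoder.* At stage $j$ Alice draws a uniformly random $K_j\in\mathbb F_q^{c_j\times b}$ and transmits the $c_j$ rows of $X_j=K_jX_0$. Every other node transmits on each of its hyperedges a linear combination, with independent uniformly random coefficients, of all the packets it has received earlier in the stage. Alice also draws independent uniform evaluation points $r_1,r_2,\dots\in\mathbb F_q$ ($bc_j$ of them at stage $j$, and one more at stage $1$), forms the matrix $D_j$ whose column belonging to $r$ is $(r,r^2,\dots,r^{n+b})^T$, and sends these points and the hash $H_j=X_0D_j$ to Bob over a secret channel. *Adversary.* Calvin knows everything except what is sent over the secret channel: he may choose, as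 an arbitrary function of $W$, all $K_j$ and all the coding coefficients, an error packet to be added on each hyperedge, provided that at stage $j$ the min cut from the hyperedges he corrupts to Bob is at most $z_j$, where $z_j<M_j$ for all $j$. *Decoder.* After stage $i$, let $Y^{(i)}$ be the matrix of all packets that Bob has received, $D^{(i)}=[D_1\cdots D_i]$ and $H^{(i)}=[H_1\cdots H_i]$. Bob considers the solutions $X^s$ of $X^sY^{(i)}D^{(i)}=H^{(i)}$. If there are solutions and all of them give the same matrix $X^sY^{(i)}$, he decodes to this matrix; if there is no solution, he waits for more redundancy; otherwise he declares a decoding failure. *Claim.* Fix $b$, $n$, the networks, the numbers $z_j$ and $i\ge 1$, and let $q\to\infty$ over prime powers; all limits are uniform in $W$ and in Calvin's strategy. 1. If $b+\sum_{j=1}^i z_j\le\sum_{j=1}^i M_j$, then the probability that Bob decodes to $X_0$ after stage $i$ tends to $1$. 2. Whether or not this inequality holds, with probability tending to $1$ Bob decodes to $X_0$ after stage $i$ if $X_0$ lies in the row space of $Y^{(i)}$, and waits for more redundancy otherwise; in particular the probability that he decodes to a wrong matrix or declares a failure tends to $0$. -/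

import Mathlib

open scoped Classical

/-- The network during one stage (one use of the network): a directed hypergraph on the node set `V`.
Every hyperedge carries one packet from its transmitting node `tail e` to all nodes in `heads e`.
The hyperedges are listed in order of transmission (for an acyclic hypergraph: any topological
order). -/
structure StageNetwork (V : Type*) where
  numEdges : ℕ
  tail : Fin numEdges → V
  heads : Fin numEdges → Set V

namespace StageNetwork

variable {V : Type*} (G : StageNetwork V) (alice bob : V)

abbrev Edge : Type := Fin G.numEdges

/-- The hyperedges leaving the source: its transmission opportunities during the stage. -/
abbrev SourceEdge : Type := {e : G.Edge // G.tail e = alice}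

/-- The hyperedges that reach the destination: the packets it receives during the stage. -/
abbrev SinkEdge : Type := {e : G.Edge // bob ∈ G.heads e}

/-- The number of transmission opportunities of the source. -/
noncomputable def numSource : ℕ := Nat.card (G.SourceEdge alice)

/-- The packet on `e'` is one of the incoming packets combined by the (non-source) transmitter
of `e`. -/
def Feeds (e' e : G.Edge) : Prop :=
  e' < e ∧ G.tail e ∈ G.heads e' ∧ G.tail e ≠ alice

/-- A directed path of hyperedges that begins with a hyperedge of `A` and ends at the
destination. -/
def IsPath (A : Set G.Edge) (l : List G.Edge) : Prop :=
  l.IsChain (G.Feeds alice) ∧ (∃ e ∈ l.head?, e ∈ A) ∧ (∃ e ∈ l.getLast?, bob ∈ G.heads e)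

/-- `C` separates `A` from the destination: removing the hyperedges of `C` destroys all paths. -/
def IsCut (A : Set G.Edge) (C : Finset G.Edge) : Prop :=
  ∀ l : List G.Edge, G.IsPath alice bob A l → ∃ e ∈ l, e ∈ C

/-- The min cut between packets entering the network on the hyperedges of `A` and the
destination. -/
noncomputable def minCut (A : Set G.Edge) : ℕ :=
  sInf {k | ∃ C : Finset G.Edge, G.IsCut alice bob A C ∧ C.card = k}

/-- The min cut from the source to the destination. -/
noncomputable def capacity : ℕ :=
  G.minCut alice bob {e | G.tail e = alice}

/-- The packet actually carried by a hyperedge. The source transmits the rows of `X`; every other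
node transmits linear combinations, with coefficients `β`, of its incoming packets; the adversary
adds the error packet `Z e` on the hyperedge `e` (`Z e = 0` where he does not interfere). -/
noncomputable def packet {F κ : Type*} [Field F] (X : Matrix (G.SourceEdge alice) κ F)
    (β : Matrix G.Edge G.Edge F) (Z : Matrix G.Edge κ F) (e : G.Edge) : κ → F :=
  (if h : G.tail e = alice then X ⟨e, h⟩
    else ∑ e' : G.Edge, if _h : G.Feeds alice e' e then β e e' • packet X β Z e' else 0) + Z e
termination_by e
decreasing_by exact _h.1

end StageNetwork

namespace RatelessCode

/-- The three possible reactions of the destination at the end of a stage. -/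
inductive Outcome (α : Type*) where
  | decoded (x : α)
  | wait
  | failure

/-- The matrices `X = Xˢ Y` reconstructed from the solutions `Xˢ` of `Xˢ Y D = H`. -/
def candidates {F ι ρ κ δ : Type*} [Field F] [Fintype ρ] [Fintype κ]
    (Y : Matrix ρ κ F) (D : Matrix κ δ F) (H : Matrix ι δ F) : Set (Matrix ι κ F) :=
  {X | ∃ Xs : Matrix ι ρ F, Xs * Y * D = H ∧ X = Xs * Y}

/-- The decoder: output the reconstruction if it is unique, wait if there is no solution, and
declare a failure if there are several reconstructions. -/
noncomputable def decode {F ι ρ κ δ : Type*} [Field F] [Fintype ρ] [Fintype κ]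
    (Y : Matrix ρ κ F) (D : Matrix κ δ F) (H : Matrix ι δ F) : Outcome (Matrix ι κ F) :=
  if h : ∃! X, X ∈ candidates Y D H then .decoded h.choose
  else if candidates Y D H = ∅ then .wait
  else .failure

/-- `X₀ = (W  I_b)`. -/
def message {F : Type*} [Field F] {b n : ℕ} (W : Matrix (Fin b) (Fin n) F) :
    Matrix (Fin b) (Fin n ⊕ Fin b) F :=
  Matrix.fromCols W 1

section Scheme

variable {V : Type*} (alice bob : V) (net : ℕ → StageNetwork V) (b n i : ℕ) (F : Type*)

/-- The number of hash columns sent at a stage: `b c_j`, plus one at the first stage. The stages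
are numbered from `0` here. -/
noncomputable def numHash (j : ℕ) : ℕ :=
  b * (net j).numSource alice + if j = 0 then 1 else 0

/-- The random choices of the first `i` stages that the adversary observes: the matrices `K_j` of
the source and the coding coefficients of the intermediate nodes. -/
abbrev PublicRandom : Type _ :=
  (∀ j : Fin i, Matrix ((net j).SourceEdge alice) (Fin b) F) ×
    (∀ j : Fin i, Matrix (net j).Edge (net j).Edge F)

/-- The secret evaluation points of the first `i` stages. -/
abbrev SecretRandom : Type _ :=
  ∀ j : Fin i, Fin (numHash alice net b j) → F

/-- The error packets of the adversary in the first `i` stages, as a function of everything but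
the secret channel. -/
abbrev Strategy : Type _ :=
  PublicRandom alice net b i F →
    ∀ j : Fin i, Matrix (net j).Edge (Fin n ⊕ Fin b) F

variable {alice net b n i F}

/-- At stage `j` the min cut between the hyperedges corrupted by the adversary and the destination
is at most `z j`. -/
def Strategy.Admissible [Field F] (calvin : Strategy alice net b n i F) (z : ℕ → ℕ) : Prop :=
  ∀ (ω : PublicRandom alice net b i F) (j : Fin i),
    (net j).minCut alice bob {e | calvin ω j e ≠ 0} ≤ z j

/-- `Y⁽ⁱ⁾`: all packets received in the first `i` stages; stage `j` transmits `X_j = K_j X₀`. -/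
noncomputable def received [Field F] (W : Matrix (Fin b) (Fin n) F)
    (calvin : Strategy alice net b n i F) (ω : PublicRandom alice net b i F) :
    Matrix (Σ j : Fin i, (net j).SinkEdge bob) (Fin n ⊕ Fin b) F :=
  fun s => (net s.1).packet alice (ω.1 s.1 * message W) (ω.2 s.1) (calvin ω s.1) s.2

/-- `D⁽ⁱ⁾`: the entry in row `k ∈ {1, …, n + b}` and the column of the evaluation point `r` is
`r ^ k`. -/
def hashMatrix [Field F] (r : SecretRandom alice net b i F) :
    Matrix (Fin n ⊕ Fin b) (Σ j : Fin i, Fin (numHash alice net b j)) F :=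
  fun k s => r s.1 s.2 ^ ((finSumFinEquiv k : Fin (n + b)).val + 1)

/-- `X₀` lies in the row space of `Y⁽ⁱ⁾`. -/
def InRowSpace [Field F] (W : Matrix (Fin b) (Fin n) F)
    (calvin : Strategy alice net b n i F) (ω : PublicRandom alice net b i F) : Prop :=
  ∃ Xs : Matrix (Fin b) (Σ j : Fin i, (net j).SinkEdge bob) F,
    Xs * received bob W calvin ω = message W

/-- The reaction of the destination at the end of the `i`-th stage. The secret channel gives it
`D⁽ⁱ⁾` and `H⁽ⁱ⁾ = X₀ D⁽ⁱ⁾`. -/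
noncomputable def outcome [Field F] (W : Matrix (Fin b) (Fin n) F)
    (calvin : Strategy alice net b n i F)
    (ω : PublicRandom alice net b i F × SecretRandom alice net b i F) :
    Outcome (Matrix (Fin b) (Fin n ⊕ Fin b) F) :=
  decode (received bob W calvin ω.1) (hashMatrix ω.2) (message W * hashMatrix ω.2)

end Scheme

/-- The probability of `E` under the uniform distribution on a finite type. -/
noncomputable def uniformProb {Ω : Type*} (E : Ω → Prop) : ℝ :=
  (Nat.card {ω // E ω} : ℝ) / Nat.card Ω

end RatelessCode

/-! The failure probability is bounded by O(1/q) from two kinds of events, with constants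
independent of `W` and of the adversary.

Hash collisions. By linearity, the received matrix is `messageTransfer` times the message plus
`errorTransfer` times some `E`, where the errors of stage j enter through a cut of at most z_j
hyperedges. Once the public randomness is fixed, the row space of Y therefore lies in a space with
at most q^(b+∑z_j) vectors, chosen without knowledge of the secret points. A vector differing from a
row of X₀ gives a nonzero polynomial of degree at most n+b, and it passes only if every secret point
is a root. Since z_j < M_j ≤ c_j, there are more than b+∑z_j points, so a union bound leaves a
factor 1/q. Without a collision X₀ is the only possible candidate, and it is one exactly when it
lies in the row space of Y. This gives the second claim.

Decodability. X₀ lies in the row space as soon as no nonzero v has T_j K_j v in the range of B_j at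
all stages j, where T_j and B_j are the transfer matrices from the source and from the cut. Barring
coincidences among the coding coefficients, T_j has rank at least M_j
(`exists_cut_card_le_finrank`), so the preimage P_j of the range of B_j has codimension at least M_j
- z_j. For fixed v ≠ 0 the vectors K_j v are uniform and independent, so all lie in P_j with
probability at most q^(-b). Only q^(b-1) vectors v with a given coordinate equal to 1 need be
tested. The cuts depend on the adversary, but a union over all sets of hyperedges costs a constant
independent of q. -/

namespace StageNetwork

/-! ### Cuts in terms of reachability. -/

variable {V : Type*} (G : StageNetwork V) (alice bob : V)

/-- `e` can be reached by a path that begins in `A` and avoids `C`. -/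
inductive Reach (A : Set G.Edge) (C : Finset G.Edge) : G.Edge → Prop
  | base {e : G.Edge} : e ∈ A → e ∉ C → Reach A C e
  | step {e' e : G.Edge} : Reach A C e' → G.Feeds alice e' e → e ∉ C → Reach A C e

variable {G alice bob}

theorem Reach.notMem {A : Set G.Edge} {C : Finset G.Edge} {e : G.Edge}
    (h : G.Reach alice A C e) : e ∉ C := by
  cases h <;> assumption

theorem Reach.anti {A : Set G.Edge} {C C' : Finset G.Edge} (hC : C ⊆ C') {e : G.Edge}
    (h : G.Reach alice A C' e) : G.Reach alice A C e := by
  induction h with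
  | base h₁ h₂ => exact .base h₁ fun h => h₂ (hC h)
  | step _ h₁ h₂ ih => exact .step ih h₁ fun h => h₂ (hC h)

theorem Reach.exists_path {A : Set G.Edge} {C : Finset G.Edge} {e : G.Edge}
    (h : G.Reach alice A C e) :
    ∃ l : List G.Edge, l.IsChain (G.Feeds alice) ∧ (∃ x ∈ l.head?, x ∈ A) ∧
      e ∈ l.getLast? ∧ ∀ x ∈ l, x ∉ C := by
  induction h with
  | @base e h₁ h₂ => exact ⟨[e], by simp, by simpa using h₁, by simp, by simpa using h₂⟩
  | @step e' e _ h₁ h₂ ih =>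
    obtain ⟨l, hl, ⟨x, hx, hxA⟩, hlast, hC⟩ := ih
    refine ⟨l ++ [e], ?_, ⟨x, ?_, hxA⟩, by simp, ?_⟩
    · rw [List.isChain_append]
      refine ⟨hl, by simp, ?_⟩
      intro y hy w hw
      obtain rfl : e' = y := by rw [Option.mem_def] at hlast hy; simpa [hlast] using hy
      obtain rfl : e = w := by simpa using hw
      exact h₁
    · rw [Option.mem_def] at hx ⊢
      simp [hx]
    · intro y hy
      rcases List.mem_append.1 hy with hy | hy
      · exact hC y hy
      · rw [List.mem_singleton.1 hy]; exact h₂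

theorem reach_of_isChain {A : Set G.Edge} {C : Finset G.Edge} (l : List G.Edge) :
    ∀ a : G.Edge, (a :: l).IsChain (G.Feeds alice) → G.Reach alice A C a → (∀ x ∈ l, x ∉ C) →
      ∀ x ∈ a :: l, G.Reach alice A C x := by
  induction l with
  | nil => intro a _ h _ x hx; rwa [List.mem_singleton.1 hx]
  | cons c l ih =>
    intro a hl h hC x hx
    rw [List.isChain_cons_cons] at hl
    rcases List.mem_cons.1 hx with rfl | hx
    · exact h
    · exact ih c hl.2 (.step h hl.1 (hC c (by simp))) (fun y hy => hC y (by simp [hy])) x hx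

/-- Trades paths for an inductive predicate, so that later arguments can step back from a hyperedge
to those feeding it. -/
theorem isCut_iff {A : Set G.Edge} {C : Finset G.Edge} :
    G.IsCut alice bob A C ↔ ∀ e, G.Reach alice A C e → bob ∉ G.heads e := by
  constructor
  · intro h e he hb
    obtain ⟨l, h₁, h₂, h₃, h₄⟩ := he.exists_path
    obtain ⟨x, hx, hxC⟩ := h l ⟨h₁, h₂, e, h₃, hb⟩
    exact h₄ x hx hxC
  · rintro h l ⟨hl, ⟨x, hx, hxA⟩, e, he, hb⟩
    by_contra! hC
    cases l with
    | nil => simp at hx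
    | cons a l =>
      obtain rfl : a = x := by simpa using hx
      exact h e (reach_of_isChain l a hl (.base hxA (hC a (by simp)))
        (fun y hy => hC y (by simp [hy])) e (List.mem_of_mem_getLast? he)) hb

variable (G alice bob) in
theorem exists_isCut_card_eq_minCut (A : Set G.Edge) :
    ∃ C : Finset G.Edge, G.IsCut alice bob A C ∧ C.card = G.minCut alice bob A := by
  refine Nat.sInf_mem (s := {k | ∃ C : Finset G.Edge, G.IsCut alice bob A C ∧ C.card = k})
    ⟨_, Finset.univ, ?_, rfl⟩
  exact isCut_iff.2 fun e he => absurd (Finset.mem_univ e) he.notMem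

theorem minCut_le_card {A : Set G.Edge} {C : Finset G.Edge} (h : G.IsCut alice bob A C) :
    G.minCut alice bob A ≤ C.card :=
  Nat.sInf_le ⟨C, h, rfl⟩

variable (G alice bob) in
theorem capacity_le_numSource : G.capacity alice bob ≤ G.numSource alice := by
  have h : G.IsCut alice bob {e | G.tail e = alice}
      (Finset.univ.filter fun e => G.tail e = alice) := by
    refine isCut_iff.2 fun e he => ?_
    exfalso
    induction he with
    | base h₁ h₂ => exact h₂ (by simpa using h₁)
    | step _ _ _ ih => exact ih
  refine (minCut_le_card h).trans (le_of_eq ?_)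
  rw [numSource, Nat.card_eq_fintype_card, Fintype.card_subtype]

/-! ### Packets as linear functions of source packets and errors. -/

section Packet

variable {F κ : Type*} [Field F]

theorem packet_source (X : Matrix (G.SourceEdge alice) κ F) (β : Matrix G.Edge G.Edge F)
    (Z : Matrix G.Edge κ F) {e : G.Edge} (h : G.tail e = alice) :
    G.packet alice X β Z e = X ⟨e, h⟩ + Z e := by
  rw [packet, dif_pos h]

theorem packet_of_ne (X : Matrix (G.SourceEdge alice) κ F) (β : Matrix G.Edge G.Edge F)
    (Z : Matrix G.Edge κ F) {e : G.Edge} (h : G.tail e ≠ alice) :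
    G.packet alice X β Z e =
      (∑ e' : G.Edge, if G.Feeds alice e' e then β e e' • G.packet alice X β Z e' else 0) +
        Z e := by
  rw [packet, dif_neg h]
  simp only [dite_eq_ite]

variable (G alice) in
/-- The global coding vector of a hyperedge: the combination of the source packets that it carries
in the absence of errors. -/
noncomputable def coding (β : Matrix G.Edge G.Edge F) : Matrix G.Edge (G.SourceEdge alice) F :=
  G.packet alice 1 β 0

variable (G alice) in
/-- The combinations of the packets on the hyperedges of `C` that are carried by the hyperedges
behind the cut `C`. -/
noncomputable def cutCoding (β : Matrix G.Edge G.Edge F) (C : Finset G.Edge) :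
    Matrix G.Edge C F :=
  G.packet alice 0 (Matrix.of fun e e' => if e ∈ C then 0 else β e e')
    (Matrix.of fun e c => if e = c.1 then 1 else 0)

theorem coding_source (β : Matrix G.Edge G.Edge F) (s : G.SourceEdge alice) :
    G.coding alice β s.1 = Pi.single s 1 := by
  rw [coding, packet_source _ _ _ s.2]
  ext
  simp [Matrix.one_apply, Pi.single_apply, eq_comm]

theorem coding_of_ne (β : Matrix G.Edge G.Edge F) {e : G.Edge} (h : G.tail e ≠ alice) :
    G.coding alice β e =
      ∑ e', if G.Feeds alice e' e then β e e' • G.coding alice β e' else 0 := by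
  have := packet_of_ne (1 : Matrix (G.SourceEdge alice) (G.SourceEdge alice) F) β 0 h
  exact this.trans (add_zero _)

theorem packet_eq_coding_add (X : Matrix (G.SourceEdge alice) κ F) (β : Matrix G.Edge G.Edge F)
    (Z : Matrix G.Edge κ F) (e : G.Edge) :
    G.packet alice X β Z e = (G.coding alice β * X) e + G.packet alice 0 β Z e := by
  induction e using WellFoundedLT.induction with
  | ind e ih =>
    by_cases h : G.tail e = alice
    · have := coding_source β ⟨e, h⟩
      simp only at this
      rw [packet_source _ _ _ h, packet_source _ _ _ h, Matrix.mul_apply_eq_vecMul, this,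
        Matrix.single_one_vecMul]
      ext k
      simp [Matrix.row]
    · rw [packet_of_ne _ _ _ h, packet_of_ne _ _ _ h]
      rw [Matrix.mul_apply_eq_vecMul, coding_of_ne β h, Matrix.sum_vecMul, ← add_assoc,
        ← Finset.sum_add_distrib]
      congr 1
      refine Finset.sum_congr rfl fun e' _ => ?_
      split_ifs with hf
      · rw [ih e' hf.1, smul_add, Matrix.smul_vecMul, Matrix.mul_apply_eq_vecMul]
      · simp

/-- Coefficients into `C` are zeroed in `cutCoding`, so nothing upstream disturbs the injected unit
vectors: hyperedges of the cut act as fresh sources. -/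
theorem cutCoding_of_mem (β : Matrix G.Edge G.Edge F) {C : Finset G.Edge} {e : G.Edge}
    (h : e ∈ C) : G.cutCoding alice β C e = Pi.single ⟨e, h⟩ 1 := by
  ext c
  by_cases ha : G.tail e = alice
  · rw [cutCoding, packet_source _ _ _ ha]
    simp [Pi.single_apply, Subtype.ext_iff, eq_comm]
  · rw [cutCoding, packet_of_ne _ _ _ ha]
    simp [h, Pi.single_apply, Subtype.ext_iff, eq_comm]

theorem cutCoding_source (β : Matrix G.Edge G.Edge F) {C : Finset G.Edge} {e : G.Edge}
    (h : e ∉ C) (ha : G.tail e = alice) : G.cutCoding alice β C e = 0 := by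
  ext c
  have hc : e ≠ c := fun h' => h (h' ▸ c.2)
  rw [cutCoding, packet_source _ _ _ ha]
  simp [hc]

theorem cutCoding_of_ne (β : Matrix G.Edge G.Edge F) {C : Finset G.Edge} {e : G.Edge}
    (h : e ∉ C) (ha : G.tail e ≠ alice) : G.cutCoding alice β C e =
      ∑ e', if G.Feeds alice e' e then β e e' • G.cutCoding alice β C e' else 0 := by
  ext c
  have hc : e ≠ c := fun h' => h (h' ▸ c.2)
  rw [cutCoding, packet_of_ne _ _ _ ha]
  simp [h, hc]

/-- An unreachable hyperedge outside `C` carries no injected error, and its feeders are unreachable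
too, so the recursion closes. All error influence on it has passed through `C`. -/
theorem packet_zero_eq_cutCoding_mul (β : Matrix G.Edge G.Edge F) (Z : Matrix G.Edge κ F)
    {C : Finset G.Edge} (e : G.Edge) (h : ¬ G.Reach alice {e | Z e ≠ 0} C e) :
    G.packet alice 0 β Z e =
      (G.cutCoding alice β C * Matrix.of fun c : C => G.packet alice 0 β Z c) e := by
  induction e using WellFoundedLT.induction with
  | ind e ih =>
    rw [Matrix.mul_apply_eq_vecMul]
    by_cases hC : e ∈ C
    · rw [cutCoding_of_mem β hC, Matrix.single_one_vecMul]
      rfl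
    have hZ : Z e = 0 := by
      by_contra hZ
      exact h (.base hZ hC)
    by_cases ha : G.tail e = alice
    · rw [packet_source _ _ _ ha, cutCoding_source β hC ha, hZ, Matrix.zero_vecMul]
      ext; simp
    · rw [packet_of_ne _ _ _ ha, cutCoding_of_ne β hC ha, hZ, add_zero, Matrix.sum_vecMul]
      refine Finset.sum_congr rfl fun e' _ => ?_
      split_ifs with hf
      · rw [ih e' hf.1 fun hr => h (.step hr hf hC), Matrix.smul_vecMul,
          Matrix.mul_apply_eq_vecMul]
      · simp

theorem coding_apply_eq_zero (β : Matrix G.Edge G.Edge F) (s : G.SourceEdge alice) (e : G.Edge)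
    (h : e < s.1) : G.coding alice β e s = 0 := by
  induction e using WellFoundedLT.induction with
  | ind e ih =>
    by_cases ha : G.tail e = alice
    · rw [coding, packet_source _ _ _ ha]
      have : (⟨e, ha⟩ : G.SourceEdge alice) ≠ s := fun h' => h.ne (congrArg Subtype.val h')
      simp [this]
    · rw [coding_of_ne β ha, Finset.sum_apply]
      refine Finset.sum_eq_zero fun e' _ => ?_
      split_ifs with hf
      · simp [ih e' hf.1 (hf.1.trans h)]
      · rfl

theorem packet_congr (X : Matrix (G.SourceEdge alice) κ F) {β β' : Matrix G.Edge G.Edge F}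
    (Z : Matrix G.Edge κ F) {e₀ : G.Edge} (h : ∀ e < e₀, β e = β' e) (e : G.Edge) (he : e < e₀) :
    G.packet alice X β Z e = G.packet alice X β' Z e := by
  induction e using WellFoundedLT.induction with
  | ind e ih =>
    by_cases ha : G.tail e = alice
    · rw [packet_source _ _ _ ha, packet_source _ _ _ ha]
    · rw [packet_of_ne _ _ _ ha, packet_of_ne _ _ _ ha, h e he]
      congr 1
      refine Finset.sum_congr rfl fun e' _ => ?_
      split_ifs with hf
      · rw [ih e' hf.1 (hf.1.trans he)]
      · rfl

/-! ### Min cut bounds rank for nondegenerate coefficients. -/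

variable (G alice) in
/-- A coincidence among the coding coefficients: the packet on `e'`, which feeds `e`, is innovative
with respect to the earlier packets on `S`, but the packet on `e` is not. -/
def Degenerate (β : Matrix G.Edge G.Edge F) (e e' : G.Edge) (S : Finset G.Edge) : Prop :=
  (∀ x ∈ S, x < e) ∧ G.Feeds alice e' e ∧
    G.coding alice β e' ∉ Submodule.span F (G.coding alice β '' S) ∧
    G.coding alice β e ∈ Submodule.span F (G.coding alice β '' S)

/-- Process the last hyperedge e of `S`. If its packet is innovative, e joins the cut and accounts
for one dimension. Otherwise nondegeneracy puts the packets of all its feeders in the span of the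
others, so the feeders can replace e in `S` without enlarging the span. -/
theorem exists_cut_card_le_finrank (β : Matrix G.Edge G.Edge F)
    (hβ : ∀ e e' S, ¬ G.Degenerate alice β e e' S) (t : ℕ) :
    ∀ S : Finset G.Edge, (∀ x ∈ S, x.val < t) → ∃ C : Finset G.Edge,
      C.card ≤ Module.finrank F (Submodule.span F (G.coding alice β '' S)) ∧
      ∀ e ∈ S, ¬ G.Reach alice {e | G.tail e = alice} C e := by
  induction t with
  | zero =>
    intro S hS
    exact ⟨∅, by simp, fun e he => absurd (hS e he) (by simp)⟩
  | succ t ih =>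
    intro S hS
    by_cases hall : ∀ x ∈ S, x.val < t
    · exact ih S hall
    push Not at hall
    obtain ⟨e, heS, het⟩ := hall
    have het : e.val = t := le_antisymm (Nat.lt_succ_iff.1 (hS e heS)) het
    have hlt : ∀ x ∈ S.erase e, x < e := by
      intro x hx
      have h₁ := hS x (Finset.mem_of_mem_erase hx)
      have h₂ : x.val ≠ e.val := fun h => Finset.ne_of_mem_erase hx (Fin.ext h)
      rw [Fin.lt_def]; omega
    have hmono : Submodule.span F (G.coding alice β '' (S.erase e : Finset G.Edge)) ≤
        Submodule.span F (G.coding alice β '' S) :=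
      Submodule.span_mono (Set.image_mono (Finset.coe_subset.2 (Finset.erase_subset e S)))
    have key : G.coding alice β e ∉
          Submodule.span F (G.coding alice β '' (S.erase e : Finset G.Edge)) →
        ∃ C : Finset G.Edge,
          C.card ≤ Module.finrank F (Submodule.span F (G.coding alice β '' S)) ∧
          ∀ e ∈ S, ¬ G.Reach alice {e | G.tail e = alice} C e := by
      intro hnot
      obtain ⟨C, hC, hcut⟩ := ih (S.erase e) fun x hx => by
        have := hlt x hx; rw [Fin.lt_def] at this; omega
      refine ⟨insert e C, (Finset.card_insert_le _ _).trans ?_, ?_⟩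
      · refine Nat.succ_le_of_lt (hC.trans_lt (Submodule.finrank_lt_finrank_of_lt ?_))
        refine lt_of_le_of_ne hmono fun h => hnot (h ▸ Submodule.subset_span ⟨e, heS, rfl⟩)
      · intro x hx hr
        by_cases hxe : x = e
        · exact hr.notMem (by simp [hxe])
        · exact hcut x (Finset.mem_erase.2 ⟨hxe, hx⟩) (hr.anti (Finset.subset_insert _ _))
    by_cases ha : G.tail e = alice
    · apply key
      intro hmem
      -- A source hyperedge is always innovative: its own coordinate vanishes on all earlier
      -- packets.
      have hle : Submodule.span F (G.coding alice β '' (S.erase e : Finset G.Edge)) ≤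
          LinearMap.ker (LinearMap.proj (R := F) (φ := fun _ : G.SourceEdge alice => F) ⟨e, ha⟩) := by
        rw [Submodule.span_le]
        rintro _ ⟨x, hx, rfl⟩
        exact coding_apply_eq_zero β ⟨e, ha⟩ x (hlt x hx)
      have := hle hmem
      have h₂ := coding_source β ⟨e, ha⟩
      simp only at h₂
      simp [h₂] at this
    · by_cases hin : G.coding alice β e ∈
          Submodule.span F (G.coding alice β '' (S.erase e : Finset G.Edge))
      swap
      · exact key hin
      have hfeed : ∀ e', G.Feeds alice e' e → G.coding alice β e' ∈
          Submodule.span F (G.coding alice β '' (S.erase e : Finset G.Edge)) := by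
        intro e' hf
        by_contra hc
        exact hβ e e' (S.erase e) ⟨hlt, hf, hc, hin⟩
      obtain ⟨C, hC, hcut⟩ := ih (S.erase e ∪ Finset.univ.filter fun e' => G.Feeds alice e' e)
        fun x hx => by
          have : x < e := by
            rcases Finset.mem_union.1 hx with hx | hx
            · exact hlt x hx
            · exact (Finset.mem_filter.1 hx).2.1
          rw [Fin.lt_def] at this; omega
      refine ⟨C, hC.trans (Submodule.finrank_mono ?_), ?_⟩
      · refine le_trans ?_ hmono
        rw [Submodule.span_le]
        rintro _ ⟨x, hx, rfl⟩
        rcases Finset.mem_union.1 hx with hx | hx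
        · exact Submodule.subset_span ⟨x, hx, rfl⟩
        · exact hfeed x (Finset.mem_filter.1 hx).2
      · intro x hx hr
        by_cases hxe : x = e
        · subst hxe
          cases hr with
          | base h _ => exact ha h
          | @step e' _ hr hf _ =>
            exact hcut e' (Finset.mem_union_right _ (by simpa using hf)) hr
        · exact hcut x (Finset.mem_union_left _ (Finset.mem_erase.2 ⟨hxe, hx⟩)) hr

variable (G alice bob) in
/-- The transfer matrix from the source to the destination. -/
noncomputable def transfer (β : Matrix G.Edge G.Edge F) :
    Matrix (G.SinkEdge bob) (G.SourceEdge alice) F :=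
  (G.coding alice β).submatrix Subtype.val id

variable (G alice bob) in
/-- The transfer matrix from the hyperedges of a cut to the destination. -/
noncomputable def cutTransfer (β : Matrix G.Edge G.Edge F) (C : Finset G.Edge) :
    Matrix (G.SinkEdge bob) C F :=
  (G.cutCoding alice β C).submatrix Subtype.val id

theorem capacity_le_rank_transfer (β : Matrix G.Edge G.Edge F)
    (hβ : ∀ e e' S, ¬ G.Degenerate alice β e e' S) :
    G.capacity alice bob ≤ (G.transfer alice bob β).rank := by
  obtain ⟨C, hC, hcut⟩ := exists_cut_card_le_finrank β hβ G.numEdges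
    (Finset.univ.filter fun e => bob ∈ G.heads e) fun x _ => x.2
  refine (minCut_le_card (isCut_iff.2 fun e he hb => hcut e (by simpa using hb) he)).trans
    (hC.trans (le_of_eq ?_))
  rw [Matrix.rank_eq_finrank_span_row]
  suffices h : G.coding alice β '' ↑(Finset.univ.filter fun e => bob ∈ G.heads e) =
      Set.range (G.transfer alice bob β).row by rw [h]
  ext y
  constructor
  · rintro ⟨x, hx, rfl⟩
    exact ⟨⟨x, by simpa using hx⟩, rfl⟩
  · rintro ⟨x, rfl⟩
    exact ⟨x.1, by simp, rfl⟩

/-- A minimum cut below the corrupted hyperedges carries everything the errors contribute. `E`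
collects the error parts of the packets on it. -/
theorem exists_packet_sink_eq (X : Matrix (G.SourceEdge alice) κ F) (β : Matrix G.Edge G.Edge F)
    (Z : Matrix G.Edge κ F) :
    ∃ C : Finset G.Edge, C.card = G.minCut alice bob {e | Z e ≠ 0} ∧ ∃ E : Matrix C κ F,
      (Matrix.of fun s : G.SinkEdge bob => G.packet alice X β Z s) =
        G.transfer alice bob β * X + G.cutTransfer alice bob β C * E := by
  obtain ⟨C, hC, hcard⟩ := G.exists_isCut_card_eq_minCut alice bob {e | Z e ≠ 0}
  refine ⟨C, hcard, Matrix.of fun c : C => G.packet alice 0 β Z c, ?_⟩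
  ext s k
  have h₁ := congrFun (packet_eq_coding_add X β Z s.1) k
  have h₂ := congrFun (packet_zero_eq_cutCoding_mul β Z (C := C) s.1
    fun hr => isCut_iff.1 hC _ hr s.2) k
  rw [Pi.add_apply, h₂] at h₁
  exact h₁

/-- Changing a single coefficient makes at most one choice of it degenerate. -/
theorem Degenerate.shift_unique (β : Matrix G.Edge G.Edge F) (e e' : G.Edge) (S : Finset G.Edge)
    {t t' : F} (h : G.Degenerate alice (β + Matrix.single e e' t) e e' S)
    (h' : G.Degenerate alice (β + Matrix.single e e' t') e e' S) : t = t' := by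
  obtain ⟨hS, hf, hnot, hmem⟩ := h
  obtain ⟨-, -, -, hmem'⟩ := h'
  have hlow : ∀ t x, x < e → G.coding alice (β + Matrix.single e e' t) x = G.coding alice β x := by
    intro t x hx
    refine packet_congr _ _ (fun y hy => ?_) x hx
    ext k
    simp [hy.ne']
  have himg : ∀ t, G.coding alice (β + Matrix.single e e' t) '' (S : Set G.Edge) =
      G.coding alice β '' S := fun t => Set.image_congr fun x hx => hlow t x (hS x hx)
  have hval : ∀ t, G.coding alice (β + Matrix.single e e' t) e =
      G.coding alice β e + t • G.coding alice β e' := by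
    intro t
    rw [coding_of_ne _ hf.2.2, coding_of_ne _ hf.2.2]
    have : t • G.coding alice β e' =
        ∑ x, if x = e' then t • G.coding alice β x else 0 := by simp
    rw [this, ← Finset.sum_add_distrib]
    refine Finset.sum_congr rfl fun x _ => ?_
    by_cases hx : x = e'
    · subst hx
      simp [hf, hlow t x hf.1, add_smul]
    · by_cases hfx : G.Feeds alice x e
      · simp [hfx, hx, hlow t x hfx.1, Ne.symm hx]
      · simp [hfx, hx]
  -- Only the packet on e moves, along the direction of the packet on e'. Two points of this line in
  -- the span would force that direction into the span.
  rw [himg, hlow _ _ hf.1] at hnot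
  rw [himg, hval] at hmem hmem'
  by_contra hne
  refine hnot ((Submodule.smul_mem_iff _ (sub_ne_zero.2 hne)).1 ?_)
  convert Submodule.sub_mem _ hmem hmem' using 1
  rw [sub_smul]; abel

end Packet

end StageNetwork

/-! ### Counting and linear algebra. -/

theorem Nat.card_exists_le {ι α : Type*} [Fintype ι] [Finite α] (p : ι → α → Prop) :
    Nat.card {a // ∃ i, p i a} ≤ ∑ i, Nat.card {a // p i a} := by
  rw [← Nat.card_sigma]
  refine Nat.card_le_card_of_injective
    (fun a : {a // ∃ i, p i a} => (⟨a.2.choose, a.1, a.2.choose_spec⟩ : Σ i, {a // p i a})) ?_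
  intro a a' h
  rw [Sigma.mk.injEq] at h
  obtain ⟨h₁, h₂⟩ := h
  ext
  have : ∀ (i i' : ι) (x : {a // p i a}) (x' : {a // p i' a}), i = i' → HEq x x' → x.1 = x'.1 := by
    rintro i _ x x' rfl h
    rw [eq_of_heq h]
  exact this _ _ _ _ h₁ h₂

/-- Rank–nullity for `f` restricted to the preimage of `R`: the image lies in `R` and the kernel in
that of `f`. -/
theorem LinearMap.finrank_comap_add_finrank_range_le {K M N : Type*} [DivisionRing K]
    [AddCommGroup M] [Module K M] [FiniteDimensional K M] [AddCommGroup N] [Module K N]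
    [FiniteDimensional K N] (f : M →ₗ[K] N) (R : Submodule K N) :
    Module.finrank K (R.comap f) + Module.finrank K (LinearMap.range f) ≤
      Module.finrank K M + Module.finrank K R := by
  have h₁ := (f.domRestrict (R.comap f)).finrank_range_add_finrank_ker
  have h₂ := f.finrank_range_add_finrank_ker
  have h₃ : Module.finrank K (LinearMap.range (f.domRestrict (R.comap f))) ≤
      Module.finrank K R := by
    refine Submodule.finrank_mono ?_
    rintro _ ⟨x, rfl⟩
    exact x.2
  have h₄ : Module.finrank K (LinearMap.ker (f.domRestrict (R.comap f))) ≤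
      Module.finrank K (LinearMap.ker f) := by
    rw [← Submodule.finrank_map_subtype_eq]
    refine Submodule.finrank_mono ?_
    rintro _ ⟨x, hx, rfl⟩
    exact hx
  omega

/-- Modulo the range of `B` the map `A` stays injective; `L` is the quotient map followed by a left
inverse. -/
theorem Matrix.exists_mul_eq_one_and_mul_eq_zero {F ι κ μ : Type*} [Field F] [Fintype ι]
    [Fintype κ] [DecidableEq κ] [Fintype μ] (A : Matrix ι κ F) (B : Matrix ι μ F)
    (h : ∀ v w, A.mulVec v = B.mulVec w → v = 0) :
    ∃ L : Matrix κ ι F, L * A = 1 ∧ L * B = 0 := by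
  let R := LinearMap.range B.mulVecLin
  obtain ⟨g, hg⟩ := (R.mkQ ∘ₗ A.mulVecLin).exists_leftInverse_of_injective (by
    rw [LinearMap.ker_eq_bot']
    intro v hv
    obtain ⟨w, hw⟩ := (Submodule.Quotient.mk_eq_zero R).1 hv
    exact h v w hw.symm)
  have hL : ∀ x, (LinearMap.toMatrix' (g ∘ₗ R.mkQ)).mulVec x = g (R.mkQ x) := fun x => by
    rw [LinearMap.toMatrix'_mulVec]; rfl
  refine ⟨LinearMap.toMatrix' (g ∘ₗ R.mkQ), ?_, ?_⟩
  · refine Matrix.ext_of_mulVec_single fun k => ?_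
    rw [← Matrix.mulVec_mulVec, hL, Matrix.one_mulVec]
    exact LinearMap.congr_fun hg _
  · refine Matrix.ext_of_mulVec_single fun k => ?_
    rw [← Matrix.mulVec_mulVec, hL, Matrix.zero_mulVec]
    have : R.mkQ (B.mulVec (Pi.single k 1)) = 0 :=
      (Submodule.Quotient.mk_eq_zero R).2 ⟨_, rfl⟩
    rw [this, map_zero]

namespace RatelessCode

/-! ### Uniform probability and averaging over translates. -/

section Probability

variable {Ω : Type*} [Finite Ω]

theorem uniformProb_mono {E E' : Ω → Prop} (h : ∀ ω, E ω → E' ω) :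
    uniformProb E ≤ uniformProb E' := by
  unfold uniformProb
  gcongr
  exact Nat.card_le_card_of_injective (fun ω : {ω // E ω} => (⟨ω.1, h _ ω.2⟩ : {ω // E' ω}))
    fun _ _ h => Subtype.ext (congrArg (fun x : {ω // E' ω} => x.1) h)

theorem uniformProb_or_le (E E' : Ω → Prop) :
    uniformProb (fun ω => E ω ∨ E' ω) ≤ uniformProb E + uniformProb E' := by
  have := Fintype.ofFinite Ω
  unfold uniformProb
  rw [← add_div]
  gcongr
  simp only [Nat.card_eq_fintype_card]
  exact_mod_cast Fintype.card_subtype_or E E'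

theorem uniformProb_exists_le {ι : Type*} [Finite ι] (E : ι → Ω → Prop) (c : ℝ)
    (h : ∀ i, uniformProb (E i) ≤ c) :
    uniformProb (fun ω => ∃ i, E i ω) ≤ Nat.card ι * c := by
  have := Fintype.ofFinite ι
  calc uniformProb (fun ω => ∃ i, E i ω) ≤ ∑ i, uniformProb (E i) := by
        unfold uniformProb
        rw [← Finset.sum_div]
        gcongr
        exact_mod_cast Nat.card_exists_le E
    _ ≤ ∑ _i : ι, c := Finset.sum_le_sum fun i _ => h i
    _ = Nat.card ι * c := by simp

theorem one_sub_le_uniformProb [Nonempty Ω] {E B : Ω → Prop} (h : ∀ ω, ¬ B ω → E ω) :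
    1 - uniformProb B ≤ uniformProb E := by
  have h₁ : uniformProb (fun _ : Ω => True) = 1 := by
    have : (Nat.card Ω : ℝ) ≠ 0 := by exact_mod_cast Nat.card_pos.ne'
    have h : Nat.card {_ω : Ω // True} = Nat.card Ω :=
      Nat.card_congr (Equiv.subtypeUnivEquiv fun _ => trivial)
    rw [uniformProb, h, div_self this]
  have h₂ := (uniformProb_mono (E := fun _ : Ω => True) (E' := fun ω => E ω ∨ B ω) fun ω _ => by
    by_cases hB : B ω
    · exact Or.inr hB
    · exact Or.inl (h ω hB)).trans (uniformProb_or_le E B)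
  linarith

/-- Conditioning on the orbits of a family of translations. -/
theorem uniformProb_le_of_translates [AddGroup Ω] {T : Type*} [Finite T] [Nonempty T]
    (φ : T → Ω) (E : Ω → Prop) (a q : ℕ) (hq : 0 < q)
    (h : ∀ ω, Nat.card {t // E (ω + φ t)} * q ≤ a * Nat.card T) :
    uniformProb E ≤ a / q := by
  have := Fintype.ofFinite Ω
  have := Fintype.ofFinite T
  have hΩ : (0 : ℝ) < Nat.card Ω := by exact_mod_cast Nat.card_pos
  have hT : 0 < Nat.card T := Nat.card_pos
  -- Double counting of pairs (ω, t): each translation is a bijection of Ω, so `φ` need not be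
  -- additive.
  have key : Nat.card T * Nat.card {ω // E ω} = ∑ ω : Ω, Nat.card {t // E (ω + φ t)} := by
    have h₁ : ∀ ω, Nat.card {t // E (ω + φ t)} = ∑ t, if E (ω + φ t) then 1 else 0 := by
      intro ω
      rw [Nat.card_eq_fintype_card, Fintype.card_subtype, Finset.card_filter]
    have h₂ : Nat.card {ω // E ω} = ∑ ω, if E ω then 1 else 0 := by
      rw [Nat.card_eq_fintype_card, Fintype.card_subtype, Finset.card_filter]
    simp_rw [h₁]
    rw [Finset.sum_comm, h₂]
    have : ∀ t, ∑ ω, (if E (ω + φ t) then 1 else 0) = ∑ ω, if E ω then 1 else 0 := fun t =>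
      Fintype.sum_equiv (Equiv.addRight (φ t)) _ _ fun ω => rfl
    simp_rw [this]
    simp
  have hle : Nat.card T * (Nat.card {ω // E ω} * q) ≤ Nat.card T * (a * Nat.card Ω) := by
    calc Nat.card T * (Nat.card {ω // E ω} * q) = ∑ ω : Ω, Nat.card {t // E (ω + φ t)} * q := by
          rw [← mul_assoc, key, Finset.sum_mul]
      _ ≤ ∑ _ω : Ω, a * Nat.card T := Finset.sum_le_sum fun ω _ => h ω
      _ = Nat.card T * (a * Nat.card Ω) := by simp; ring
  have := Nat.le_of_mul_le_mul_left hle hT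
  rw [uniformProb, div_le_div_iff₀ hΩ (by exact_mod_cast hq)]
  exact_mod_cast this

end Probability

/-! ### The decoder and hash collisions. -/

theorem decode_eq_decoded {F ι ρ κ δ : Type*} [Field F] [Fintype ρ] [Fintype κ]
    {Y : Matrix ρ κ F} {D : Matrix κ δ F} {H : Matrix ι δ F} {X : Matrix ι κ F}
    (h : candidates Y D H = {X}) : decode Y D H = .decoded X := by
  have hX : ∃! X, X ∈ candidates Y D H := ⟨X, by simp [h], fun y hy => by simpa [h] using hy⟩
  have : hX.choose = X := by simpa [h] using hX.choose_spec.1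
  rw [decode, dif_pos hX, this]

theorem decode_eq_wait {F ι ρ κ δ : Type*} [Field F] [Fintype ρ] [Fintype κ]
    {Y : Matrix ρ κ F} {D : Matrix κ δ F} {H : Matrix ι δ F}
    (h : candidates Y D H = ∅) : decode Y D H = .wait := by
  have hX : ¬ ∃! X, X ∈ candidates Y D H := by
    rintro ⟨X, hX, -⟩
    simp [h] at hX
  rw [decode, dif_neg hX, if_pos h]

section Scheme

variable {V : Type*} {alice bob : V} {net : ℕ → StageNetwork V} {b n i : ℕ} {F : Type*} [Field F]

variable (bob) in
/-- The columns by which the destination observes the message, in the absence of errors. -/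
noncomputable def messageTransfer (ω : PublicRandom alice net b i F) :
    Matrix (Σ j : Fin i, (net j).SinkEdge bob) (Fin b) F :=
  Matrix.of fun s => ((net s.1).transfer alice bob (ω.2 s.1) * ω.1 s.1) s.2

variable (bob) in
/-- The columns by which the destination observes the packets on the hyperedges of the cuts `C`. -/
noncomputable def errorTransfer (ω : PublicRandom alice net b i F)
    (C : ∀ j : Fin i, Finset (net j).Edge) :
    Matrix (Σ j : Fin i, (net j).SinkEdge bob) (Σ j : Fin i, C j) F :=
  Matrix.blockDiagonal' fun j => (net j).cutTransfer alice bob (ω.2 j) (C j)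

theorem exists_received_eq {z : ℕ → ℕ} {calvin : Strategy alice net b n i F}
    (hc : calvin.Admissible bob z) (W : Matrix (Fin b) (Fin n) F)
    (ω : PublicRandom alice net b i F) :
    ∃ C : ∀ j : Fin i, Finset (net j).Edge, (∀ j, (C j).card ≤ z j) ∧
      ∃ E : Matrix (Σ j : Fin i, C j) (Fin n ⊕ Fin b) F,
        received bob W calvin ω = messageTransfer bob ω * message W + errorTransfer bob ω C * E := by
  choose C hC E hE using fun j : Fin i => StageNetwork.exists_packet_sink_eq (bob := bob)
    (ω.1 j * message W) (ω.2 j) (calvin ω j)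
  refine ⟨C, fun j => (hC j).trans_le (hc ω j), Matrix.of fun s => E s.1 s.2, ?_⟩
  ext ⟨j, s⟩ k
  have h := congrFun (congrFun (hE j) s) k
  rw [← Matrix.mul_assoc] at h
  rw [Matrix.add_apply] at h ⊢
  refine h.trans (congrArg₂ (· + ·) rfl ?_)
  simp only [Matrix.mul_apply, errorTransfer, Fintype.sum_sigma]
  rw [Finset.sum_eq_single j]
  · simp [Matrix.blockDiagonal'_apply_eq]
  · intro j' _ hj
    simp [Matrix.blockDiagonal'_apply_ne _ _ _ hj.symm]
  · simp

/-- A row of a wrong reconstruction agrees with the hash of the corresponding row of the message. -/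
def HashCollision (bob : V) (W : Matrix (Fin b) (Fin n) F) (calvin : Strategy alice net b n i F)
    (ω : PublicRandom alice net b i F × SecretRandom alice net b i F) : Prop :=
  ∃ (k : Fin b) (y : (Σ j : Fin i, (net j).SinkEdge bob) → F),
    Matrix.vecMul y (received bob W calvin ω.1) ≠ message W k ∧
    Matrix.vecMul (Matrix.vecMul y (received bob W calvin ω.1)) (hashMatrix ω.2) =
      Matrix.vecMul (message W k) (hashMatrix ω.2)

theorem candidates_subset_of_not_hashCollision {W : Matrix (Fin b) (Fin n) F}
    {calvin : Strategy alice net b n i F}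
    {ω : PublicRandom alice net b i F × SecretRandom alice net b i F}
    (h : ¬ HashCollision bob W calvin ω) :
    candidates (received bob W calvin ω.1) (hashMatrix ω.2)
      (message W * hashMatrix ω.2 : Matrix (Fin b) _ F) ⊆ {message W} := by
  rintro _ ⟨Xs, hX, rfl⟩
  rw [Set.mem_singleton_iff]
  by_contra hne
  obtain ⟨k, hk⟩ : ∃ k, (Xs * received bob W calvin ω.1) k ≠ message W k := by
    by_contra! hall
    exact hne (funext hall)
  refine h ⟨k, Xs k, ?_, ?_⟩
  · rwa [← Matrix.mul_apply_eq_vecMul]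
  · rw [← Matrix.mul_apply_eq_vecMul, ← Matrix.mul_apply_eq_vecMul, hX]
    rfl

theorem outcome_of_inRowSpace {W : Matrix (Fin b) (Fin n) F} {calvin : Strategy alice net b n i F}
    {ω : PublicRandom alice net b i F × SecretRandom alice net b i F}
    (h : ¬ HashCollision bob W calvin ω) (hrow : InRowSpace bob W calvin ω.1) :
    outcome bob W calvin ω = .decoded (message W) := by
  refine decode_eq_decoded (Y := received bob W calvin ω.1) (D := hashMatrix ω.2)
    ((candidates_subset_of_not_hashCollision h).antisymm ?_)
  obtain ⟨Xs, hXs⟩ := hrow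
  rintro _ rfl
  exact ⟨Xs, congrArg (· * hashMatrix ω.2) hXs, hXs.symm⟩

theorem outcome_of_not_inRowSpace {W : Matrix (Fin b) (Fin n) F}
    {calvin : Strategy alice net b n i F}
    {ω : PublicRandom alice net b i F × SecretRandom alice net b i F}
    (h : ¬ HashCollision bob W calvin ω) (hrow : ¬ InRowSpace bob W calvin ω.1) :
    outcome bob W calvin ω = .wait := by
  refine decode_eq_wait (Y := received bob W calvin ω.1) (D := hashMatrix ω.2)
    (Set.eq_empty_of_forall_notMem ?_)
  rintro X hX
  obtain rfl : X = message W := candidates_subset_of_not_hashCollision h hX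
  obtain ⟨Xs, -, hXs⟩ := hX
  exact hrow ⟨Xs, hXs.symm⟩

variable (alice net b i) in
/-- The number of hash columns of the first `i` stages. -/
noncomputable def totalHash : ℕ := ∑ j ∈ Finset.range i, numHash alice net b j

theorem card_secretRandom {K : Type*} [Finite K] :
    Nat.card (SecretRandom alice net b i K) = Nat.card K ^ totalHash alice net b i := by
  rw [Nat.card_pi, totalHash, Finset.sum_range, ← Finset.prod_pow_eq_pow_sum]
  exact Finset.prod_congr rfl fun j _ => by simp [Nat.card_fun]

/-- The entries of `y` are the coefficients of a nonzero polynomial of degree at most n+b, and every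
evaluation point must be one of its roots. -/
theorem card_hash_eq_zero_le [Finite F] {y : Fin n ⊕ Fin b → F} (hy : y ≠ 0) :
    Nat.card {r : SecretRandom alice net b i F // Matrix.vecMul y (hashMatrix r) = 0} ≤
      (n + b) ^ totalHash alice net b i := by
  let p : Polynomial F := ∑ k, Polynomial.monomial ((finSumFinEquiv k : Fin (n + b)).val + 1) (y k)
  have hcoeff : ∀ k, p.coeff ((finSumFinEquiv k : Fin (n + b)).val + 1) = y k := by
    intro k
    rw [Polynomial.finsetSum_coeff, Finset.sum_eq_single k]
    · simp
    · intro k' _ hk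
      rw [Polynomial.coeff_monomial, if_neg]
      exact fun h => hk (finSumFinEquiv.injective (Fin.ext (by omega)))
    · simp
  have hp : p ≠ 0 := by
    intro hp
    exact hy (funext fun k => by rw [← hcoeff k, hp]; simp)
  have hdeg : p.natDegree ≤ n + b := by
    refine Polynomial.natDegree_sum_le_of_forall_le _ _ fun k _ => ?_
    exact (Polynomial.natDegree_monomial_le _).trans (finSumFinEquiv k).2
  have hcard : Nat.card {x // x ∈ p.roots.toFinset} ≤ n + b := by
    rw [Nat.card_eq_fintype_card, Fintype.card_coe]
    exact (Multiset.toFinset_card_le _).trans ((Polynomial.card_roots' p).trans hdeg)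
  have hroot : ∀ (r : SecretRandom alice net b i F), Matrix.vecMul y (hashMatrix r) = 0 →
      ∀ j s, r j s ∈ p.roots.toFinset := by
    intro r hr j s
    rw [Multiset.mem_toFinset, Polynomial.mem_roots hp, Polynomial.IsRoot.def]
    have := congrFun hr ⟨j, s⟩
    simpa [p, Polynomial.eval_finsetSum, Matrix.vecMul, dotProduct, hashMatrix] using this
  calc _ ≤ Nat.card (∀ j : Fin i, Fin (numHash alice net b j) → {x // x ∈ p.roots.toFinset}) := by
        refine Nat.card_le_card_of_injective (fun r j s => ⟨r.1 j s, hroot r.1 r.2 j s⟩) ?_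
        intro r r' h
        ext j s
        exact congrArg Subtype.val (congrFun (congrFun h j) s)
    _ = Nat.card {x // x ∈ p.roots.toFinset} ^ totalHash alice net b i := by
        rw [Nat.card_pi, totalHash, Finset.sum_range, ← Finset.prod_pow_eq_pow_sum]
        exact Finset.prod_congr rfl fun j _ => by simp [Nat.card_fun]
    _ ≤ _ := Nat.pow_le_pow_left hcard _

/-- From z_j + 1 ≤ M_j ≤ c_j, each b c_j covers z_j, and the first stage even covers b + z_0. The
extra point there makes the inequality strict, which yields the factor 1/q. -/
theorem add_sum_lt_totalHash {z : ℕ → ℕ} (hz : ∀ j, z j < (net j).capacity alice bob)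
    (hi : 1 ≤ i) (hb : 1 ≤ b) :
    b + ∑ j ∈ Finset.range i, z j < totalHash alice net b i := by
  obtain ⟨m, rfl⟩ : ∃ m, i = m + 1 := ⟨i - 1, by omega⟩
  have hlt : ∀ j, z j + 1 ≤ (net j).numSource alice := fun j =>
    (hz j).trans_le ((net j).capacity_le_numSource alice bob)
  have hle : ∀ j, z j ≤ b * (net j).numSource alice := fun j => by nlinarith [hlt j]
  have h₀ : b + z 0 ≤ b * (net 0).numSource alice := by
    obtain ⟨b, rfl⟩ : ∃ b', b = b' + 1 := ⟨b - 1, by omega⟩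
    nlinarith [hlt 0]
  rw [totalHash, Finset.sum_range_succ', Finset.sum_range_succ']
  have h₁ : ∑ j ∈ Finset.range m, z (j + 1) ≤
      ∑ j ∈ Finset.range m, numHash alice net b (j + 1) :=
    Finset.sum_le_sum fun j _ => by simpa [numHash] using hle (j + 1)
  have h₂ : b + z 0 < numHash alice net b 0 := by simp only [numHash, if_pos]; omega
  omega

theorem uniformProb_hashCollision_le [Finite F] {z : ℕ → ℕ}
    (hz : ∀ j, z j < (net j).capacity alice bob) (hi : 1 ≤ i)
    (W : Matrix (Fin b) (Fin n) F) (calvin : Strategy alice net b n i F)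
    (hc : calvin.Admissible bob z) :
    uniformProb (HashCollision bob W calvin) ≤
      (b * (n + b) ^ totalHash alice net b i : ℕ) / (Nat.card F : ℝ) := by
  have := Fintype.ofFinite F
  refine uniformProb_le_of_translates
    (fun r : SecretRandom alice net b i F => ((0 : PublicRandom alice net b i F), r))
    _ _ _ Nat.card_pos fun ω => ?_
  rw [card_secretRandom]
  rcases Nat.eq_zero_or_pos b with rfl | hb
  · have : IsEmpty {t // HashCollision bob W calvin
        (ω + ((0 : PublicRandom alice net 0 i F), t))} := ⟨fun t => t.2.choose.elim0⟩
    simp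
  obtain ⟨C, hC, E, hY⟩ := exists_received_eq hc W ω.1
  -- The union bound runs over these parameters u rather than over y: there are at most q^(b+∑z_j)
  -- of them, however many packets were received.
  let x : (Fin b → F) × ((Σ j : Fin i, C j) → F) → Fin n ⊕ Fin b → F := fun u =>
    Matrix.vecMul u.1 (message W) + Matrix.vecMul u.2 E
  let ι := Fin b × (Fin b → F) × ((Σ j : Fin i, C j) → F)
  let p : ι → SecretRandom alice net b i F → Prop := fun u r =>
    x u.2 - message W u.1 ≠ 0 ∧ Matrix.vecMul (x u.2 - message W u.1) (hashMatrix r) = 0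
  have hp : ∀ u, Nat.card {r // p u r} ≤ (n + b) ^ totalHash alice net b i := by
    intro u
    by_cases hu : x u.2 - message W u.1 = 0
    · have : IsEmpty {r // p u r} := ⟨fun r => r.2.1 hu⟩
      simp
    · simpa only [p, hu, ne_eq, not_false_eq_true, true_and] using card_hash_eq_zero_le hu
  have hcard : Nat.card {t // HashCollision bob W calvin
      (ω + ((0 : PublicRandom alice net b i F), t))} ≤ Nat.card {r // ∃ u, p u r} := by
    refine Nat.card_le_card_of_injective (fun t => ⟨ω.2 + t.1, ?_⟩) ?_
    · obtain ⟨k, y, h₁, h₂⟩ := t.2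
      have hω : (ω + ((0 : PublicRandom alice net b i F), t.1)).1 = ω.1 := add_zero _
      rw [hω] at h₁ h₂
      have hx : Matrix.vecMul y (received bob W calvin ω.1) =
          x (Matrix.vecMul y (messageTransfer bob ω.1),
            Matrix.vecMul y (errorTransfer bob ω.1 C)) := by
        rw [hY, Matrix.vecMul_add]
        simp only [x, Matrix.vecMul_vecMul]
      rw [hx] at h₁ h₂
      refine ⟨(k, _), sub_ne_zero.2 h₁, ?_⟩
      rw [Matrix.sub_vecMul, sub_eq_zero]
      exact h₂
    · intro t t' h
      exact Subtype.ext (add_left_cancel (congrArg Subtype.val h))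
  have hι : Nat.card ι ≤ b * Nat.card F ^ (b + ∑ j ∈ Finset.range i, z j) := by
    have : ∑ j : Fin i, (C j).card ≤ ∑ j ∈ Finset.range i, z j := by
      rw [Finset.sum_range]
      exact Finset.sum_le_sum fun j _ => hC j
    rw [Nat.card_prod, Nat.card_prod, Nat.card_fun, Nat.card_fun, ← pow_add]
    simp only [Nat.card_eq_fintype_card, Fintype.card_fin, Fintype.card_sigma, Fintype.card_coe]
    gcongr
    exact Fintype.card_pos
  have hq : 1 ≤ Nat.card F := Nat.card_pos
  calc _ ≤ (Nat.card ι * (n + b) ^ totalHash alice net b i) * Nat.card F := by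
        gcongr
        refine hcard.trans ((Nat.card_exists_le p).trans ?_)
        refine (Finset.sum_le_sum fun u _ => hp u).trans (le_of_eq ?_)
        simp
    _ ≤ (b * Nat.card F ^ (b + ∑ j ∈ Finset.range i, z j) * (n + b) ^ totalHash alice net b i) *
        Nat.card F := by gcongr
    _ = b * (n + b) ^ totalHash alice net b i *
        Nat.card F ^ (b + ∑ j ∈ Finset.range i, z j + 1) := by ring
    _ ≤ _ := by
        gcongr
        exact add_sum_lt_totalHash hz hi hb

end Scheme

end RatelessCode

namespace RatelessCode

/-! ### Decodability of the message. -/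

section Scheme

variable {V : Type*} {alice bob : V} {net : ℕ → StageNetwork V} {b n i : ℕ} {F : Type*} [Field F]

/-- Some coding coefficient of the first `i` stages is degenerate. -/
def CodingDegenerate (ω : PublicRandom alice net b i F × SecretRandom alice net b i F) : Prop :=
  ∃ u : Σ j : Fin i, (net j).Edge × (net j).Edge × Finset (net j).Edge,
    (net u.1).Degenerate alice (ω.1.2 u.1) u.2.1 u.2.2.1 u.2.2.2

variable (alice net i) in
/-- The number of possible coincidences considered in `CodingDegenerate`. -/
noncomputable def degenerateCount : ℕ :=
  Nat.card (Σ j : Fin i, (net j).Edge × (net j).Edge × Finset (net j).Edge)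

theorem uniformProb_codingDegenerate_le [Finite F] :
    uniformProb (CodingDegenerate (alice := alice) (net := net) (b := b) (i := i) (F := F)) ≤
      degenerateCount net i * ((1 : ℕ) / (Nat.card F : ℝ)) := by
  refine uniformProb_exists_le _ _ ?_
  rintro ⟨j, e, e', S⟩
  -- Randomize only the coefficient from e' to e; by `shift_unique` at most one of its q values is
  -- degenerate.
  refine uniformProb_le_of_translates
    (fun t : F => (((0, Pi.single j (Matrix.single e e' t)) : PublicRandom alice net b i F),
      (0 : SecretRandom alice net b i F))) _ _ _ Nat.card_pos fun ω => ?_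
  rw [one_mul]
  refine (Nat.mul_le_mul_right _ ?_).trans (one_mul _).le
  rw [Finite.card_le_one_iff_subsingleton]
  refine ⟨fun t t' => Subtype.ext ?_⟩
  have h := t.2
  have h' := t'.2
  simp only [Prod.fst_add, Prod.snd_add, Pi.add_apply, Pi.single_eq_same] at h h'
  exact h.shift_unique _ _ _ _ h'

/-- The errors behind the cuts `C` can cancel a combination of the columns of the transfer matrix
of the message in which the column `m` has coefficient one. -/
def Confusable (bob : V) (C : ∀ j : Fin i, Finset (net j).Edge) (m : Fin b)
    (ω : PublicRandom alice net b i F × SecretRandom alice net b i F) : Prop :=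
  ∃ v : Fin b → F, v m = 1 ∧ ∀ j : Fin i, ∃ w,
    ((net j).transfer alice bob (ω.1.2 j)).mulVec ((ω.1.1 j).mulVec v) =
      ((net j).cutTransfer alice bob (ω.1.2 j) (C j)).mulVec w

theorem inRowSpace_of_not_confusable {z : ℕ → ℕ} {calvin : Strategy alice net b n i F}
    (hc : calvin.Admissible bob z) (W : Matrix (Fin b) (Fin n) F)
    (ω : PublicRandom alice net b i F × SecretRandom alice net b i F)
    (h : ∀ C : ∀ j : Fin i, Finset (net j).Edge, (∀ j, (C j).card ≤ z j) →
      ∀ m, ¬ Confusable bob C m ω) :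
    InRowSpace bob W calvin ω.1 := by
  obtain ⟨C, hC, E, hY⟩ := exists_received_eq hc W ω.1
  obtain ⟨L, hL₁, hL₂⟩ := Matrix.exists_mul_eq_one_and_mul_eq_zero (messageTransfer bob ω.1)
    (errorTransfer bob ω.1 C) (by
      intro v w hvw
      by_contra hv
      obtain ⟨m, hm⟩ := Function.ne_iff.1 hv
      refine h C hC m ⟨(v m)⁻¹ • v, by simpa using inv_mul_cancel₀ hm,
        fun j => ⟨(v m)⁻¹ • fun c => w ⟨j, c⟩, ?_⟩⟩
      rw [Matrix.mulVec_smul, Matrix.mulVec_smul, Matrix.mulVec_smul, Matrix.mulVec_mulVec]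
      congr 1
      ext s
      refine (congrFun hvw ⟨j, s⟩).trans ?_
      simp only [Matrix.mulVec, dotProduct, errorTransfer, Fintype.sum_sigma]
      rw [Finset.sum_eq_single j]
      · simp [Matrix.blockDiagonal'_apply_eq]
      · intro j' _ hj
        simp [Matrix.blockDiagonal'_apply_ne _ _ _ hj.symm]
      · simp)
  refine ⟨L, ?_⟩
  rw [hY, Matrix.mul_add, ← Matrix.mul_assoc, ← Matrix.mul_assoc, hL₁, hL₂, Matrix.one_mul,
    Matrix.zero_mul, add_zero]

theorem card_normalized_mul_le [Finite F] (m : Fin b) :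
    Nat.card {v : Fin b → F // v m = 1} * Nat.card F ≤ Nat.card F ^ b := by
  have h : Nat.card ({v : Fin b → F // v m = 1} × F) ≤ Nat.card (Fin b → F) := by
    refine Nat.card_le_card_of_injective (fun u => Function.update u.1.1 m u.2) ?_
    rintro ⟨v, c⟩ ⟨v', c'⟩ h
    have hl := fun l => congrFun h l
    refine Prod.ext (Subtype.ext (funext fun l => ?_)) (by simpa using hl m)
    rcases eq_or_ne l m with rfl | hlm
    · exact v.2.trans v'.2.symm
    · simpa [hlm] using hl l
  simpa [Nat.card_prod, Nat.card_fun] using h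

/-- Adding w_j to column `m` of K_j turns K_j v into K_j v + w_j, because v m = 1. So w is recovered
from v and the points K_j v + w_j of the preimages. -/
theorem card_confusable_shift_le [Finite F] (C : ∀ j : Fin i, Finset (net j).Edge) (m : Fin b)
    (ω : PublicRandom alice net b i F × SecretRandom alice net b i F) :
    Nat.card {w : ∀ j : Fin i, (net j).SourceEdge alice → F // Confusable bob C m
      (ω + ((fun j => Matrix.of fun s l => if l = m then w j s else 0, 0), 0))} ≤
      Nat.card {v : Fin b → F // v m = 1} * ∏ j : Fin i, Nat.card
        ((LinearMap.range ((net j).cutTransfer alice bob (ω.1.2 j) (C j)).mulVecLin).comap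
          ((net j).transfer alice bob (ω.1.2 j)).mulVecLin) := by
  rw [← Nat.card_pi, ← Nat.card_prod]
  have hK : ∀ (w : ∀ j : Fin i, (net j).SourceEdge alice → F) (j : Fin i) (v : Fin b → F),
      v m = 1 → (ω.1.1 j + Matrix.of fun s l => if l = m then w j s else 0).mulVec v =
        (ω.1.1 j).mulVec v + w j := by
    intro w j v hv
    rw [Matrix.add_mulVec]
    congr 1
    ext s
    simp [Matrix.mulVec, dotProduct, hv]
  choose v hv hw using fun w : {w : ∀ j : Fin i, (net j).SourceEdge alice → F // Confusable bob C m
      (ω + ((fun j => Matrix.of fun s l => if l = m then w j s else 0, 0), 0))} => w.2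
  have hmem : ∀ w (j : Fin i), (ω.1.1 j).mulVec (v w) + w.1 j ∈
      (LinearMap.range ((net j).cutTransfer alice bob (ω.1.2 j) (C j)).mulVecLin).comap
        ((net j).transfer alice bob (ω.1.2 j)).mulVecLin := by
    intro w j
    obtain ⟨y, hy⟩ := hw w j
    simp only [Prod.fst_add, Prod.snd_add, Pi.add_apply, Pi.zero_apply, add_zero,
      hK w.1 j _ (hv w)] at hy
    exact ⟨y, hy.symm⟩
  refine Nat.card_le_card_of_injective (fun w => (⟨v w, hv w⟩, fun j => ⟨_, hmem w j⟩)) ?_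
  intro w w' h
  rw [Prod.mk.injEq, Subtype.mk.injEq] at h
  obtain ⟨h₁, h₂⟩ := h
  refine Subtype.ext (funext fun j => ?_)
  have := congrArg Subtype.val (congrFun h₂ j)
  simp only [h₁] at this
  exact add_left_cancel this

theorem uniformProb_confusable_le [Finite F] {z : ℕ → ℕ}
    (hb : b + ∑ j ∈ Finset.range i, z j ≤
      ∑ j ∈ Finset.range i, (net j).capacity alice bob)
    (C : ∀ j : Fin i, Finset (net j).Edge) (hC : ∀ j, (C j).card ≤ z j) (m : Fin b) :
    uniformProb (fun ω : PublicRandom alice net b i F × SecretRandom alice net b i F =>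
      ¬ CodingDegenerate ω ∧ Confusable bob C m ω) ≤ (1 : ℕ) / (Nat.card F : ℝ) := by
  have hq : 0 < Nat.card F := Nat.card_pos
  refine uniformProb_le_of_translates
    (fun w : ∀ j : Fin i, (net j).SourceEdge alice → F =>
      (((fun j => Matrix.of fun s l => if l = m then w j s else 0, 0) :
        PublicRandom alice net b i F), (0 : SecretRandom alice net b i F))) _ _ _ hq fun ω => ?_
  -- The shift changes only the K_j, so degeneracy is constant along the orbit.
  by_cases hdeg : CodingDegenerate ω
  · have : IsEmpty {w : ∀ j : Fin i, (net j).SourceEdge alice → F //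
        ¬ CodingDegenerate (ω + (((fun j => Matrix.of fun s l => if l = m then w j s else 0, 0) :
        PublicRandom alice net b i F), (0 : SecretRandom alice net b i F))) ∧
        Confusable bob C m (ω + (((fun j => Matrix.of fun s l => if l = m then w j s else 0, 0) :
        PublicRandom alice net b i F), (0 : SecretRandom alice net b i F)))} := by
      refine ⟨fun w => w.2.1 ?_⟩
      obtain ⟨u, hu⟩ := hdeg
      exact ⟨u, by simpa only [Prod.fst_add, Prod.snd_add, add_zero] using hu⟩
    simp
  let P : ∀ j : Fin i, Submodule F ((net j).SourceEdge alice → F) := fun j =>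
    (LinearMap.range ((net j).cutTransfer alice bob (ω.1.2 j) (C j)).mulVecLin).comap
      ((net j).transfer alice bob (ω.1.2 j)).mulVecLin
  -- That is, dim P_j ≤ c_j - M_j + z_j. Summed over j, the hypothesis `hb` leaves room for b more
  -- dimensions, enough for the choice of v and a factor q.
  have hP : ∀ j : Fin i, Module.finrank F (P j) + (net j).capacity alice bob ≤
      Nat.card ((net j).SourceEdge alice) + z j := by
    intro j
    have h₁ := ((net j).transfer alice bob (ω.1.2 j)).mulVecLin.finrank_comap_add_finrank_range_le
      (LinearMap.range ((net j).cutTransfer alice bob (ω.1.2 j) (C j)).mulVecLin)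
    have h₂ : Module.finrank F
        (LinearMap.range ((net j).cutTransfer alice bob (ω.1.2 j) (C j)).mulVecLin) ≤ z j := by
      refine (LinearMap.finrank_range_le _).trans ?_
      simpa using hC j
    have h₃ : (net j).capacity alice bob ≤
        Module.finrank F (LinearMap.range ((net j).transfer alice bob (ω.1.2 j)).mulVecLin) :=
      StageNetwork.capacity_le_rank_transfer _ fun e e' S h => hdeg ⟨⟨j, e, e', S⟩, h⟩
    rw [Module.finrank_fintype_fun_eq_card, ← Nat.card_eq_fintype_card] at h₁
    change Module.finrank F (P j) + _ ≤ _ at h₁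
    omega
  have hsum : b + ∑ j, Module.finrank F (P j) ≤
      ∑ j : Fin i, Nat.card ((net j).SourceEdge alice) := by
    have := Finset.sum_le_sum fun j (_ : j ∈ Finset.univ) => hP j
    rw [Finset.sum_add_distrib, Finset.sum_add_distrib] at this
    rw [Finset.sum_range, Finset.sum_range] at hb
    omega
  have hT : Nat.card (∀ j : Fin i, (net j).SourceEdge alice → F) =
      Nat.card F ^ ∑ j : Fin i, Nat.card ((net j).SourceEdge alice) := by
    rw [Nat.card_pi, ← Finset.prod_pow_eq_pow_sum]
    exact Finset.prod_congr rfl fun j _ => Nat.card_fun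
  have hprod : ∏ j, Nat.card (P j) = Nat.card F ^ ∑ j, Module.finrank F (P j) := by
    rw [← Finset.prod_pow_eq_pow_sum]
    exact Finset.prod_congr rfl fun j _ => Module.natCard_eq_pow_finrank
  rw [one_mul, hT]
  calc _ ≤ (Nat.card {v : Fin b → F // v m = 1} * ∏ j, Nat.card (P j)) * Nat.card F := by
        refine Nat.mul_le_mul_right _ (le_trans ?_ (card_confusable_shift_le C m ω))
        exact Nat.card_le_card_of_injective (fun w => ⟨w.1, w.2.2⟩)
          fun w w' h => Subtype.ext (by simpa using h)
    _ = (Nat.card {v : Fin b → F // v m = 1} * Nat.card F) * ∏ j, Nat.card (P j) := by ring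
    _ ≤ Nat.card F ^ b * ∏ j, Nat.card (P j) :=
        Nat.mul_le_mul_right _ (card_normalized_mul_le m)
    _ = Nat.card F ^ (b + ∑ j, Module.finrank F (P j)) := by rw [hprod, pow_add]
    _ ≤ _ := Nat.pow_le_pow_right hq hsum

variable (net b i) in
/-- The number of choices of one set of hyperedges per stage and a column. -/
noncomputable def cutCount : ℕ := Nat.card ((∀ j : Fin i, Finset (net j).Edge) × Fin b)

/-- The adversary's cuts may depend on all public randomness, so every family of small sets is
excluded at once. -/
theorem uniformProb_exists_confusable_le [Finite F] {z : ℕ → ℕ}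
    (hb : b + ∑ j ∈ Finset.range i, z j ≤
      ∑ j ∈ Finset.range i, (net j).capacity alice bob) :
    uniformProb (fun ω : PublicRandom alice net b i F × SecretRandom alice net b i F =>
      ∃ u : (∀ j : Fin i, Finset (net j).Edge) × Fin b, (∀ j, (u.1 j).card ≤ z j) ∧
        ¬ CodingDegenerate ω ∧ Confusable bob u.1 u.2 ω) ≤
      cutCount net b i * ((1 : ℕ) / (Nat.card F : ℝ)) := by
  refine uniformProb_exists_le _ _ fun u => ?_
  by_cases hu : ∀ j, (u.1 j).card ≤ z j
  · simpa only [hu, implies_true, true_and] using uniformProb_confusable_le hb u.1 hu u.2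
  · simp only [hu, false_and]
    simp [uniformProb]

end Scheme

/-- A bound of order `1 / q` on the failure probability suffices. -/
theorem exists_forall_one_sub_le {a : ℕ} {ε : ℝ} (hε : 0 < ε) :
    ∃ q₀ : ℕ, ∀ q : ℕ, 0 < q → q₀ ≤ q → (a : ℝ) / q ≤ ε := by
  obtain ⟨q₀, hq₀⟩ := exists_nat_ge (a / ε)
  refine ⟨q₀, fun q hq hle => ?_⟩
  rw [div_le_iff₀ (by exact_mod_cast hq), mul_comm]
  exact (div_le_iff₀ hε).1 (hq₀.trans (by exact_mod_cast hle))

end RatelessCode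

theorem theorem1 {V : Type*} (alice bob : V) (net : ℕ → StageNetwork V) (b n : ℕ) (z : ℕ → ℕ)
    (hz : ∀ j, z j < (net j).capacity alice bob) (i : ℕ) (hi : 1 ≤ i) :
    (b + ∑ j ∈ Finset.range i, z j ≤ ∑ j ∈ Finset.range i, (net j).capacity alice bob →
      ∀ ε : ℝ, 0 < ε → ∃ q₀ : ℕ, ∀ (F : Type) [Field F] [Finite F], q₀ ≤ Nat.card F →
        ∀ (W : Matrix (Fin b) (Fin n) F) (calvin : RatelessCode.Strategy alice net b n i F),
          calvin.Admissible bob z →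
          1 - ε ≤ RatelessCode.uniformProb (fun ω =>
            RatelessCode.outcome bob W calvin ω =
              .decoded (RatelessCode.message W))) ∧
    (∀ ε : ℝ, 0 < ε → ∃ q₀ : ℕ, ∀ (F : Type) [Field F] [Finite F], q₀ ≤ Nat.card F →
        ∀ (W : Matrix (Fin b) (Fin n) F) (calvin : RatelessCode.Strategy alice net b n i F),
          calvin.Admissible bob z →
          1 - ε ≤ RatelessCode.uniformProb (fun ω =>
            (RatelessCode.InRowSpace bob W calvin ω.1 ∧
              RatelessCode.outcome bob W calvin ω =
                .decoded (RatelessCode.message W)) ∨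
            (¬ RatelessCode.InRowSpace bob W calvin ω.1 ∧
              RatelessCode.outcome bob W calvin ω = .wait))) := by
  constructor
  · intro hb ε hε
    obtain ⟨q₀, hq₀⟩ := RatelessCode.exists_forall_one_sub_le
      -- Sum of the numerators of the three union bounds; it involves neither the field, `W` nor the
      -- strategy, whence the uniformity.
      (a := b * (n + b) ^ RatelessCode.totalHash alice net b i +
        (RatelessCode.degenerateCount net i + RatelessCode.cutCount net b i)) hε
    refine ⟨q₀, fun F _ _ hF W calvin hc => ?_⟩
    refine le_trans ?_ (RatelessCode.one_sub_le_uniformProb (B := fun ω =>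
      RatelessCode.HashCollision bob W calvin ω ∨ RatelessCode.CodingDegenerate ω ∨
        ∃ u : (∀ j : Fin i, Finset (net j).Edge) × Fin b, (∀ j, (u.1 j).card ≤ z j) ∧
        ¬ RatelessCode.CodingDegenerate ω ∧ RatelessCode.Confusable bob u.1 u.2 ω) ?_)
    · have h := hq₀ _ Nat.card_pos hF
      have h₁ := RatelessCode.uniformProb_hashCollision_le hz hi W calvin hc
      have h₂ := RatelessCode.uniformProb_codingDegenerate_le (alice := alice) (net := net)
        (b := b) (i := i) (F := F)
      have h₃ := RatelessCode.uniformProb_exists_confusable_le (F := F) hb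
      refine sub_le_sub_left (le_trans ?_ h) 1
      refine (RatelessCode.uniformProb_or_le _ _).trans ?_
      refine (add_le_add h₁ ((RatelessCode.uniformProb_or_le _ _).trans
        (add_le_add h₂ h₃))).trans (le_of_eq ?_)
      push_cast
      ring
    · intro ω hω
      push Not at hω
      obtain ⟨h₁, h₂, h₃⟩ := hω
      exact RatelessCode.outcome_of_inRowSpace h₁
        (RatelessCode.inRowSpace_of_not_confusable hc W ω fun C hC m => h₃ (C, m) hC h₂)
  · intro ε hε
    obtain ⟨q₀, hq₀⟩ := RatelessCode.exists_forall_one_sub_le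
      (a := b * (n + b) ^ RatelessCode.totalHash alice net b i) hε
    refine ⟨q₀, fun F _ _ hF W calvin hc => ?_⟩
    refine le_trans ?_ (RatelessCode.one_sub_le_uniformProb
      (B := RatelessCode.HashCollision bob W calvin) ?_)
    · exact sub_le_sub_left
        ((RatelessCode.uniformProb_hashCollision_le hz hi W calvin hc).trans
          (hq₀ _ Nat.card_pos hF)) 1
    · intro ω hω
      by_cases hrow : RatelessCode.InRowSpace bob W calvin ω.1
      · exact Or.inl ⟨hrow, RatelessCode.outcome_of_inRowSpace hω hrow⟩
      · exact Or.inr ⟨hrow, RatelessCode.outcome_of_not_inRowSpace hω hrow⟩
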